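/- Let $p$ be a prime, let $\mathcal L_{ring}$ be the language of rings and $\mathcal L_G=\mathcal L_{ring}\cup\{G\}$ with $G$ a unary predicate. Let $\mathrm{ACF}_G$ be the $\mathcal L_G$-theory of algebraically closed fields of characteristic $p$ in which $G$ is an additive subgroup, and let $\mathrm{ACFG}$ be its model companion: the model-complete $\mathcal L_G$-theory (unique up to logical equivalence) such that every model of $\mathrm{ACF}_G$ embeds into a model of $\mathrm{ACFG}$ and every model of $\mathrm{ACFG}$ embeds into a model of $\mathrm{ACF}_G$. Let $(K,G)\models\mathrm{ACFG}$, and let $\zeta_1,\dots,\zeta_n$ be endomorphisms of the additive group $(K,+)$ which are definable in the field $K$ in the language $\mathcal L_{ring}$ (with parameters from $K$) and which are linearly independent over $\mathbb F_p$. Then the natural map $$K/\bigl(\zeta_1^{-1}(G)\cap\dots\cap\zeta_n^{-1}(G)\bigr)\longrightarrow K/\zeta_1^{-1}(G)\times\dots\times K/\zeta_n^{-1}(G),$$ sending the class of $x$ to the tuple of the classes of $x$, is an isomorphism of groups. -/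

import Mathlib

open FirstOrder FirstOrder.Language

universe u v w

/-- The only symbol of the language of a unary predicate. -/
inductive UnaryPredRel : ℕ → Type
  | mem : UnaryPredRel 1

/-- The language with a single unary predicate symbol and nothing else. -/
def unaryPredLang : FirstOrder.Language.{0, 0} where
  Functions := fun _ => Empty
  Relations := UnaryPredRel

/-- The language of rings expanded by a unary predicate symbol `G`. -/
abbrev ringPredLang : FirstOrder.Language.{0, 0} := Language.ring.sum unaryPredLang

/-- The formula `G(t)`. -/
def predG {α : Type} {n : ℕ} (t : ringPredLang.Term (α ⊕ Fin n)) :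
    ringPredLang.BoundedFormula α n :=
  Relations.boundedFormula₁ (Sum.inr UnaryPredRel.mem : ringPredLang.Relations 1) t

/-- Addition of terms in the expanded language. -/
def addTerm {α : Type} (s t : ringPredLang.Term α) : ringPredLang.Term α :=
  Functions.apply₂ (Sum.inl ringFunc.add : ringPredLang.Functions 2) s t

/-- Negation of a term in the expanded language. -/
def negTerm {α : Type} (t : ringPredLang.Term α) : ringPredLang.Term α :=
  Functions.apply₁ (Sum.inl ringFunc.neg : ringPredLang.Functions 1) t

/-- The constant `0` in the expanded language. -/
def zeroTerm {α : Type} : ringPredLang.Term α :=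
  Constants.term (Sum.inl ringFunc.zero : ringPredLang.Constants)

/-- The axioms saying that `G` is an additive subgroup: `G(0)`,
`∀ x y, G(x) → G(y) → G(x + y)`, and `∀ x, G(x) → G(-x)`. -/
def addSubgroupAxioms : ringPredLang.Theory :=
  {predG (α := Empty) (n := 0) zeroTerm,
   ∀' ∀' (predG (α := Empty) (n := 2) (&0) ⟹ predG (&1) ⟹ predG (addTerm (&0) (&1))),
   ∀' (predG (α := Empty) (n := 1) (&0) ⟹ predG (negTerm (&0)))}

/-- The theory of algebraically closed fields of characteristic `p` with a predicate `G` for an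
additive subgroup. -/
def theoryACFSubgroup (p : ℕ) : ringPredLang.Theory :=
  (LHom.sumInl : Language.ring →ᴸ ringPredLang).onTheory (Theory.ACF p) ∪ addSubgroupAxioms

/-- A theory is model complete if every embedding between models of it is elementary. -/
def IsModelComplete {L : FirstOrder.Language.{u, v}} (T : L.Theory) : Prop :=
  ∀ (M N : Theory.ModelType.{u, v, w} T) (f : M ↪[L] N) (n : ℕ) (φ : L.Formula (Fin n))
    (x : Fin n → M), φ.Realize (f ∘ x) ↔ φ.Realize x

/-- `T'` is the model companion of `T`: it is model complete, every model of `T` embeds into a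
model of `T'`, and every model of `T'` embeds into a model of `T`. (Such a `T'` is determined by
`T` up to logical equivalence.) -/
structure IsModelCompanion {L : FirstOrder.Language.{u, v}} (T T' : L.Theory) : Prop where
  modelComplete : IsModelComplete.{u, v, w} T'
  embeds : ∀ M : Theory.ModelType.{u, v, w} T,
    ∃ N : Theory.ModelType.{u, v, w} T', Nonempty (M ↪[L] N)
  embeds_back : ∀ N : Theory.ModelType.{u, v, w} T',
    ∃ M : Theory.ModelType.{u, v, w} T, Nonempty (N ↪[L] M)

/-- The interpretation of the predicate language on `K` in which the predicate is `G`. -/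
@[reducible]
def unaryPredStructure {K : Type w} (G : Set K) : unaryPredLang.Structure K where
  funMap := fun f _ => f.elim
  RelMap := fun {_} r =>
    match r with
    | UnaryPredRel.mem => fun x => x 0 ∈ G

/-- The structure `(K, G)` in the expanded language. -/
@[reducible]
def pairStructure {K : Type w} [Field K] [FirstOrder.Ring.CompatibleRing K] (G : AddSubgroup K) :
    ringPredLang.Structure K :=
  letI := unaryPredStructure (G : Set K)
  Language.sumStructure Language.ring unaryPredLang K

/-- `(K, G)` is a model of the theory `T`. -/
def PairModels {K : Type w} [Field K] [FirstOrder.Ring.CompatibleRing K] (G : AddSubgroup K)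
    (T : ringPredLang.Theory) : Prop :=
  letI := pairStructure G
  K ⊨ T

/-- `(K, G)` is a model of `ACFG`, the model companion of the theory of algebraically closed fields
of characteristic `p` with a predicate for an additive subgroup. -/
def IsModelACFG (p : ℕ) {K : Type w} [Field K] [FirstOrder.Ring.CompatibleRing K]
    (G : AddSubgroup K) : Prop :=
  ∃ T : ringPredLang.Theory,
    IsModelCompanion.{0, 0, w} (theoryACFSubgroup p) T ∧ PairModels G T

/-- The graph of `f : K → K` is definable in the field `K` in the language of rings,
with parameters from `K`. -/
def IsRingDefinable {K : Type w} [Field K] [FirstOrder.Ring.CompatibleRing K] (f : K → K) : Prop :=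
  (Set.univ : Set K).Definable Language.ring {v : Fin 2 → K | f (v 0) = v 1}

/-! Only surjectivity needs an argument: given `a i` in `K`, some `x` must satisfy `ζ i x - ζ i (a
i) ∈ G` for all `i`. By model completeness it is enough to solve this system in a larger model of
ACFG.

Let `L` be an ultrapower of `K`, `τ` the class of an injective sequence, and `ζ* i` the extension of
`ζ i` to `L`. Put `z i = ζ* i τ - ζ i (a i)` and let `H` be `G` plus the `𝔽_p`-span of the `z i`, so
that `τ` solves the system modulo `H`. That `H` meets `K` only in `G` follows once no nontrivial
combination `η = ∑ m i • ζ i` has `η* τ` in `K` (`eq_zero_of_eventually_const`). If one did, `η`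
would be constant on an infinite set, hence have infinite kernel, containing an injective sequence
`u`. For `x₀` in `K` the classes of `u` and `x₀ + u` are transcendental over `K`, hence conjugate
under `Aut(L/K)`, which commutes with definable maps. So `η x₀ = 0` for every `x₀`, against linear
independence.

Now `(L, H)` embeds in a model `N` of ACFG, in which `(K, G)` is elementary. The field `L` is
elementary in `N` (`exists_elementaryEmbedding_of_uncountable`), so `τ` still solves the system in
`N`, and `K` has a solution too. Since ACFG is given only as a model companion, algebraic closedness
of its models is derived from the `∀∃` form of the axioms of ACF. -/

/-! ### Automorphisms of algebraically closed fields and transcendental elements. -/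

/-- A bijection between equipotent types can be chosen to send a prescribed point to a prescribed
point. -/
theorem exists_equiv_apply_eq {α β : Type*} (e : α ≃ β) (a : α) (b : β) :
    ∃ e' : α ≃ β, e' a = b := by
  classical
  exact ⟨e.trans (Equiv.swap (e a) b), by simp⟩

/-- An algebraically closed field has enough automorphisms to move any transcendental element to
any other. -/
theorem IsAlgClosed.exists_algEquiv_apply_eq {F L : Type*} [Field F] [Field L] [Algebra F L]
    [IsAlgClosed L] {a b : L} (ha : Transcendental F a) (hb : Transcendental F b) :
    ∃ σ : L ≃ₐ[F] L, σ a = b := by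
  have basis : ∀ c : L, Transcendental F c →
      ∃ s : Set L, c ∈ s ∧ IsTranscendenceBasis F ((↑) : s → L) := by
    intro c hc
    obtain ⟨s, hs, h⟩ := exists_isTranscendenceBasis_superset (R := F) (s := {c})
      ((algebraicIndependent_unique_type_iff (ι := ({c} : Set L))).2 hc)
    exact ⟨s, hs rfl, h⟩
  obtain ⟨s, has, hs⟩ := basis a ha
  obtain ⟨t, hbt, ht⟩ := basis b hb
  obtain ⟨e₀⟩ := Cardinal.eq.1 (hs.cardinalMk_eq ht)
  obtain ⟨e, he⟩ := exists_equiv_apply_eq e₀ ⟨a, has⟩ ⟨b, hbt⟩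
  -- `L` is an algebraic closure of both polynomial rings `F[s]` and `F[t]`, so the isomorphism
  -- renaming variables along `e` extends to `L`.
  let _ := IsAlgClosed.isAlgClosure_of_transcendence_basis _ hs
  let _ := IsAlgClosed.isAlgClosure_of_transcendence_basis _ ht
  let E : Algebra.adjoin F (Set.range ((↑) : s → L)) ≃ₐ[F]
      Algebra.adjoin F (Set.range ((↑) : t → L)) :=
    hs.1.aevalEquiv.symm.trans ((MvPolynomial.renameEquiv F e).trans ht.1.aevalEquiv)
  have hE : ∀ q, E (hs.1.aevalEquiv q) = ht.1.aevalEquiv (MvPolynomial.rename e q) := by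
    intro q
    simp [E]
  let σ := IsAlgClosure.equivOfEquiv L L E.toRingEquiv
  have hσ : ∀ q : MvPolynomial s F, σ (MvPolynomial.aeval ((↑) : s → L) q)
      = MvPolynomial.aeval ((↑) : t → L) (MvPolynomial.rename e q) := by
    intro q
    rw [← hs.1.algebraMap_aevalEquiv, ← ht.1.algebraMap_aevalEquiv, ← hE]
    exact IsAlgClosure.equivOfEquiv_algebraMap L L E.toRingEquiv _
  refine ⟨@AlgEquiv.ofRingEquiv F L L _ _ _ _ _ σ fun r => ?_, ?_⟩
  · simpa using hσ (MvPolynomial.C r)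
  · simpa [he] using hσ (MvPolynomial.X ⟨a, has⟩)

/-- Elements outside an algebraically closed subfield are transcendental over it. -/
theorem transcendental_of_notMem_range {K L : Type*} [Field K] [Field L] [Algebra K L]
    [IsAlgClosed K] {a : L} (ha : a ∉ Set.range (algebraMap K L)) : Transcendental K a := by
  intro h
  refine ha ?_
  have h1 := h.isIntegral
  have := IsAlgClosed.degree_eq_one_of_irreducible K (minpoly.irreducible h1)
  exact minpoly.degree_eq_one_iff.1 this

/-- An uncountable field has elements transcendental over any subfield which is generated by a
countable set over a countable field. -/
theorem exists_transcendental_adjoin {F L : Type*} [Field F] [Countable F] [Field L] [Algebra F L]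
    [Uncountable L] {s : Set L} (hs : s.Countable) :
    ∃ a : L, Transcendental (IntermediateField.adjoin F s) a := by
  by_contra! h
  have hc : Countable (IntermediateField.adjoin F s) := by
    have := IntermediateField.lift_cardinalMk_adjoin_le F s
    rw [← Cardinal.mk_le_aleph0_iff, ← Cardinal.lift_le_aleph0]
    refine this.trans ?_
    simp [Cardinal.mk_le_aleph0, Cardinal.le_aleph0_iff_set_countable.2 hs]
  have hcount := Algebraic.countable (IntermediateField.adjoin F s) L
  have huniv : {x : L | IsAlgebraic (IntermediateField.adjoin F s) x} = Set.univ :=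
    Set.eq_univ_of_forall fun a => by simpa [Transcendental] using h a
  rw [huniv] at hcount
  exact Set.not_countable_univ hcount

/-! ### Model completeness and `∀∃`-sentences. -/

section ModelCompanion

variable {L : FirstOrder.Language.{u, v}}

/-- If `N` embeds into `N'` elementarily through `M`, then every `∀∃`-sentence true in `M` is
true in `N`. -/
theorem BoundedFormula.realize_alls_of_isExistential {N M N' : Type*} [L.Structure N]
    [L.Structure M] [L.Structure N'] (f : N ↪[L] M) (g : M ↪[L] N') (h : N ↪ₑ[L] N')
    (hfg : ∀ x, h x = g (f x)) {n : ℕ} {φ : L.BoundedFormula Empty n} (hφ : φ.IsExistential)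
    (hM : M ⊨ φ.alls) : N ⊨ φ.alls := by
  simp only [Sentence.Realize, BoundedFormula.realize_alls] at hM ⊢
  intro xs
  -- Existential witnesses found in `M` persist in `N'`; elementarity of `h` brings the formula back
  -- to `N`.
  have h1 := hφ.realize_embedding g (hM (f ∘ xs))
  rw [← h.map_boundedFormula]
  rw [show (g ∘ f ∘ xs : Fin n → N') = h ∘ xs from funext fun i => (hfg _).symm,
    Subsingleton.elim (g ∘ default : Empty → N') (h ∘ default)] at h1
  exact h1

/-- An embedding between models of a model complete theory is elementary. -/
def IsModelComplete.elementaryEmbedding {T : L.Theory} (hT : IsModelComplete.{u, v, w} T)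
    (M N : Theory.ModelType.{u, v, w} T) (f : M ↪[L] N) : M ↪ₑ[L] N where
  toFun := f
  map_formula' n φ x := hT M N f n φ x

end ModelCompanion

/-! ### Descent of the axioms of ACF. -/

section ACF

open FirstOrder.Field FirstOrder.Ring

/-- If `N` embeds into `N'` elementarily through an algebraically closed field, then `N` is an
algebraically closed field. -/
theorem model_ACF_of_elementaryEmbedding {p : ℕ} (hp : p.Prime) {N M N' : Type*}
    [Language.ring.Structure N] [Language.ring.Structure M] [Language.ring.Structure N']
    (f : N ↪[Language.ring] M) (g : M ↪[Language.ring] N') (h : N ↪ₑ[Language.ring] N')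
    (hfg : ∀ x, h x = g (f x)) (hM : M ⊨ Theory.ACF p) : N ⊨ Theory.ACF p := by
  have key := fun {n : ℕ} {φ : Language.ring.BoundedFormula Empty n} =>
    BoundedFormula.realize_alls_of_isExistential f g h hfg (n := n) (φ := φ)
  rw [Theory.model_iff]
  intro σ hσ
  have hMσ := hM.realize_of_mem σ hσ
  rcases hσ with (⟨ax, rfl⟩ | hσ) | ⟨n, -, rfl⟩
  · cases ax with
    | addAssoc => exact key (n := 3) (.of_isQF (.of_isAtomic (.equal _ _))) hMσ
    | zeroAdd => exact key (n := 1) (.of_isQF (.of_isAtomic (.equal _ _))) hMσ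
    | negAddCancel => exact key (n := 2) (.of_isQF (.of_isAtomic (.equal _ _))) hMσ
    | mulAssoc => exact key (n := 3) (.of_isQF (.of_isAtomic (.equal _ _))) hMσ
    | mulComm => exact key (n := 2) (.of_isQF (.of_isAtomic (.equal _ _))) hMσ
    | oneMul => exact key (n := 1) (.of_isQF (.of_isAtomic (.equal _ _))) hMσ
    | leftDistrib => exact key (n := 3) (.of_isQF (.of_isAtomic (.equal _ _))) hMσ
    | existsPairNE =>
      exact key (n := 0) (.ex (.ex (.of_isQF (.not (.of_isAtomic (.equal _ _)))))) hMσ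
    | existsInv =>
      -- The axiom is not prenex, so the quantifier over the inverse is pulled out in front of the
      -- implication; at `0` any witness serves.
      have h1 := key (n := 1) (φ := ∃' (∼(&0 =' 0) ⟹ ((&0 * &1) =' 1)))
        (.ex (.of_isQF (.imp (.not (.of_isAtomic (.equal _ _))) (.of_isAtomic (.equal _ _)))))
      simp only [FieldAxiom.toSentence, Sentence.Realize, Formula.Realize, BoundedFormula.alls,
        BoundedFormula.realize_all, BoundedFormula.realize_ex, BoundedFormula.realize_imp,
        BoundedFormula.realize_not, BoundedFormula.realize_bdEqual] at h1 hMσ ⊢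
      simp only [zero_def, one_def, Term.realize_constants, Term.realize_var, Function.comp_apply,
        Sum.elim_inr] at h1 hMσ ⊢
      intro x hx
      refine (h1 (fun y => ?_) x).imp fun y hy => hy hx
      rcases em (y = ((zeroFunc : Language.ring.Constants) : M)) with hy | hy
      · exact ⟨y, fun h => (h hy).elim⟩
      · exact (hMσ y hy).imp fun _ h _ => h
  · rw [if_neg hp.ne_zero, if_pos hp, Set.mem_singleton_iff] at hσ
    subst hσ
    exact key (n := 0) (.of_isQF (.of_isAtomic (.equal _ _))) hMσ
  · exact key (.ex (.of_isQF (.of_isAtomic (.equal _ _)))) hMσ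

end ACF

/-! ### Ring homomorphisms and formulas. -/

section RingLanguage

open FirstOrder.Ring

variable {M N : Type*} [Ring M] [CompatibleRing M] [Ring N] [CompatibleRing N]

/-- An embedding of structures in the language of rings is a ring homomorphism. -/
def ringHomOfEmbedding (f : M ↪[Language.ring] N) : M →+* N where
  toFun := f
  map_one' := by simpa using! f.map_fun oneFunc ![]
  map_zero' := by simpa using! f.map_fun zeroFunc ![]
  map_mul' x y := by simpa using! f.map_fun mulFunc ![x, y]
  map_add' x y := by simpa using! f.map_fun addFunc ![x, y]

/-- Ring isomorphisms preserve and reflect formulas in the language of rings. -/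
theorem realize_ringEquiv_comp (σ : M ≃+* N) {α : Type*} {n : ℕ}
    (φ : Language.ring.BoundedFormula α n) (v : α → M) (xs : Fin n → M) :
    φ.Realize (σ ∘ v) (σ ∘ xs) ↔ φ.Realize v xs :=
  StrongHomClass.realize_boundedFormula (languageEquivEquivRingEquiv.symm σ) φ

end RingLanguage

/-! ### Elementary embeddings of uncountable algebraically closed fields. -/

section Uncountable

open FirstOrder.Ring

variable {M N : Type*} [Field M] [CompatibleRing M] [IsAlgClosed M] [Uncountable M]
  [Field N] [CompatibleRing N] [IsAlgClosed N]

/-- An embedding of an uncountable algebraically closed field in an algebraically closed field of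
positive characteristic is elementary. -/
theorem exists_elementaryEmbedding_of_uncountable {p : ℕ} [Fact p.Prime] [CharP M p]
    (f : M ↪[Language.ring] N) : ∃ g : M ↪ₑ[Language.ring] N, ∀ x, g x = f x := by
  refine ⟨f.toElementaryEmbedding fun n φ x a ha => ?_, fun _ => rfl⟩
  by_cases hrange : a ∈ Set.range f
  · obtain ⟨b, rfl⟩ := hrange
    exact ⟨b, ha⟩
  -- Tarski–Vaught test for a witness `a` outside `M`: an automorphism of `N` fixing the parameters
  -- `x` moves it to some `b` in `M` transcendental over the countable field they generate.
  let _ : Algebra (ZMod p) M := ZMod.algebra M p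
  let _ : Algebra M N := (ringHomOfEmbedding f).toAlgebra
  let F := IntermediateField.adjoin (ZMod p) (Set.range x)
  obtain ⟨b, hb⟩ := exists_transcendental_adjoin (F := ZMod p) (Set.countable_range x)
  have hb' : Transcendental F (algebraMap M N b) :=
    (transcendental_algebraMap_iff (algebraMap M N).injective).2 hb
  have ha' : Transcendental F a :=
    (transcendental_of_notMem_range (K := M) hrange).restrictScalars (algebraMap F M).injective
  obtain ⟨σ, hσ⟩ := IsAlgClosed.exists_algEquiv_apply_eq ha' hb'
  refine ⟨b, ?_⟩
  rw [← realize_ringEquiv_comp (σ : N ≃+* N), Fin.comp_snoc] at ha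
  have hx : (σ : N ≃+* N) ∘ f ∘ x = f ∘ x := by
    funext i
    exact σ.commutes ⟨x i, IntermediateField.subset_adjoin _ _ ⟨i, rfl⟩⟩
  rw [hx, Subsingleton.elim ((σ : N ≃+* N) ∘ default) (default : Empty → N)] at ha
  rwa [show (σ : N ≃+* N) a = f b from hσ] at ha

end Uncountable

/-! ### Ultrapowers over the natural numbers. -/

section Ultrapower

open FirstOrder.Ring FirstOrder.Field Filter

variable {K : Type w} {L : Type*} [Field K] [CompatibleRing K] [Field L] [CompatibleRing L]

/-- The map `c` presents `L` as the ultrapower of the field `K` along a nonprincipal ultrafilter on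
the natural numbers. -/
structure IsUltrapower (c : (ℕ → K) →+* L) : Prop where
  surjective : Function.Surjective c
  apply_eq_iff : ∀ x y, c x = c y ↔ ∀ᶠ k in hyperfilter ℕ, x k = y k
  realize_iff : ∀ {α : Type w} (φ : Language.ring.Formula α) (x : α → ℕ → K),
    φ.Realize (fun a => c (x a)) ↔ ∀ᶠ k in hyperfilter ℕ, φ.Realize fun a => x a k

theorem exists_isUltrapower (p : ℕ) (K : Type w) [Field K] [CompatibleRing K] [IsAlgClosed K]
    [CharP K p] : ∃ (L : Type w) (_ : Field L) (_ : CompatibleRing L) (c : (ℕ → K) →+* L),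
      IsUltrapower c ∧ L ⊨ Theory.ACF p := by
  let U := ((hyperfilter ℕ : Ultrafilter ℕ) : Filter ℕ).Product fun _ : ℕ => K
  have hU : U ⊨ Theory.ACF p := by
    rw [Theory.model_iff]
    intro φ hφ
    exact (Ultraproduct.sentence_realize φ).2 (.of_forall fun _ =>
      Theory.realize_sentence_of_mem (Theory.ACF p) hφ)
  have := modelField_of_modelACF p U
  let _ := fieldOfModelField U
  let _ := compatibleRingOfModelField U
  let c : (ℕ → K) →+* U :=
    { toFun x := (x : U)
      map_one' := by
        simpa using! (Ultraproduct.funMap_cast (u := hyperfilter ℕ) oneFunc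
          (![] : Fin 0 → ℕ → K)).symm
      map_zero' := by
        simpa using! (Ultraproduct.funMap_cast (u := hyperfilter ℕ) zeroFunc
          (![] : Fin 0 → ℕ → K)).symm
      map_mul' x y := by
        simpa using! (Ultraproduct.funMap_cast (u := hyperfilter ℕ) mulFunc ![x, y]).symm
      map_add' x y := by
        simpa using! (Ultraproduct.funMap_cast (u := hyperfilter ℕ) addFunc ![x, y]).symm }
  refine ⟨U, inferInstance, inferInstance, c, ⟨Quotient.mk_surjective, fun x y => Quotient.eq, ?_⟩,
    hU⟩
  intro α φ x
  exact Ultraproduct.realize_formula_cast φ x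

namespace IsUltrapower

variable {c : (ℕ → K) →+* L}

/-- The diagonal embedding. -/
def diag (c : (ℕ → K) →+* L) : K →+* L := c.comp (Pi.constRingHom ℕ K)

/-- An injective sequence takes a given value at most once, and finite sets are not in the
ultrafilter. -/
theorem apply_notMem_range_diag (hc : IsUltrapower c) {x : ℕ → K} (hx : x.Injective) :
    c x ∉ Set.range (diag c) := by
  rintro ⟨a, ha⟩
  have h := (hc.apply_eq_iff _ _).1 ha
  refine Set.Finite.notMem_hyperfilter (s := {k | a = x k}) ?_ h
  exact Set.Subsingleton.finite fun i hi j hj => hx (hi.symm.trans hj)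

theorem exists_ringEquiv [IsAlgClosed K] [IsAlgClosed L] (hc : IsUltrapower c) {x y : ℕ → K}
    (hx : x.Injective) (hy : y.Injective) :
    ∃ σ : L ≃+* L, (∀ a, σ (diag c a) = diag c a) ∧ σ (c x) = c y := by
  let _ : Algebra K L := (diag c).toAlgebra
  obtain ⟨σ, hσ⟩ := IsAlgClosed.exists_algEquiv_apply_eq
    (transcendental_of_notMem_range (K := K) (hc.apply_notMem_range_diag hx))
    (transcendental_of_notMem_range (K := K) (hc.apply_notMem_range_diag hy))
  exact ⟨σ, σ.commutes, hσ⟩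

/-- Diagonal argument: against a list of classes of `t j`, choose `x k` different from `t 0 k, …, t
k k`. Then `x` and `t j` can agree only at indices below `j`. -/
theorem uncountable [Infinite K] (hc : IsUltrapower c) : Uncountable L := by
  refine ⟨fun h => ?_⟩
  obtain ⟨s, hs⟩ := exists_surjective_nat L
  choose t ht using fun j => hc.surjective (s j)
  classical
  have hex : ∀ k, ∃ a : K, a ∉ (Finset.range (k + 1)).image fun j => t j k := by
    exact fun k => Infinite.exists_notMem_finset _
  choose x hx using hex
  obtain ⟨j, hj⟩ := hs (c x)
  rw [← ht, hc.apply_eq_iff] at hj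
  refine Set.Finite.notMem_hyperfilter (s := {k | t j k = x k}) ?_ hj
  refine (Set.finite_lt_nat j).subset fun k hk => ?_
  by_contra hlt
  refine hx k (Finset.mem_image.2 ⟨j, by simpa using hlt, hk⟩)

end IsUltrapower

end Ultrapower

/-! ### Definable endomorphisms in the ultrapower. -/

section

open FirstOrder.Ring Filter

/-- The graph of a definable function is defined by a formula with parameters. -/
theorem IsRingDefinable.exists_formula {K : Type w} [Field K] [CompatibleRing K] {f : K → K}
    (hf : IsRingDefinable f) : ∃ φ : Language.ring.Formula ((Set.univ : Set K) ⊕ Fin 2),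
      ∀ x y, φ.Realize (Sum.elim (↑) ![x, y]) ↔ f x = y := by
  obtain ⟨φ, hφ⟩ := Set.definable_iff_exists_formula_sum.1 hf
  refine ⟨φ, fun x y => ?_⟩
  simpa using (Set.ext_iff.1 hφ ![x, y]).symm

namespace IsUltrapower

variable {K : Type w} {L : Type*} [Field K] [CompatibleRing K] [Field L] [CompatibleRing L]
  {c : (ℕ → K) →+* L}

/-- The interpretation in the ultrapower of a formula defining the graph of a function. -/
theorem realize_graph (hc : IsUltrapower c) {f : K → K}
    {φ : Language.ring.Formula ((Set.univ : Set K) ⊕ Fin 2)}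
    (hφ : ∀ x y, φ.Realize (Sum.elim (↑) ![x, y]) ↔ f x = y) (x y : ℕ → K) :
    φ.Realize (Sum.elim (fun a => diag c a) ![c x, c y]) ↔ c (f ∘ x) = c y := by
  rw [hc.apply_eq_iff]
  have h := hc.realize_iff φ (Sum.elim (fun (a : (Set.univ : Set K)) _ => (a : K)) ![x, y])
  have h1 : (fun a => c (Sum.elim (fun (a : (Set.univ : Set K)) _ => (a : K)) ![x, y] a : ℕ → K)) =
      Sum.elim (fun a : (Set.univ : Set K) => diag c a) ![c x, c y] := by
    funext a
    rcases a with a | a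
    · rfl
    · fin_cases a <;> rfl
  rw [h1] at h
  rw [h]
  refine eventually_congr (.of_forall fun k => ?_)
  rw [Function.comp_apply, ← hφ]
  refine iff_of_eq (congrArg φ.Realize (funext fun a => ?_))
  rcases a with a | a
  · rfl
  · fin_cases a <;> rfl

/-- The formula defining the graph of `f` has only diagonal parameters in `L`, and `σ` fixes these.
-/
theorem ringEquiv_apply_comp (hc : IsUltrapower c) {f : K → K} (hf : IsRingDefinable f)
    {σ : L ≃+* L} (hσ : ∀ a, σ (diag c a) = diag c a) {x y : ℕ → K} (hxy : σ (c x) = c y) :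
    σ (c (f ∘ x)) = c (f ∘ y) := by
  obtain ⟨φ, hφ⟩ := hf.exists_formula
  obtain ⟨z, hz⟩ := hc.surjective (σ (c (f ∘ x)))
  rw [← hz, eq_comm, ← hc.realize_graph hφ]
  have h := (realize_ringEquiv_comp σ φ _ default).2 ((hc.realize_graph hφ x (f ∘ x)).2 rfl)
  rw [Formula.Realize]
  convert! h using 1
  funext a
  rcases a with a | a
  · exact (hσ a).symm
  · fin_cases a
    · exact hxy.symm
    · exact hz

/-- A nontrivial linear combination of linearly independent definable endomorphisms is not constant
along an injective sequence. -/
theorem eq_zero_of_eventually_const [IsAlgClosed K] [IsAlgClosed L] {p : ℕ} [Fact p.Prime]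
    [Algebra (ZMod p) K] (hc : IsUltrapower c) {n : ℕ} {ζ : Fin n → K →+ K}
    (hdef : ∀ i, IsRingDefinable (ζ i)) (hind : LinearIndependent (ZMod p) ζ)
    {m : Fin n → ZMod p} {t : ℕ → K} (ht : t.Injective) {a : K}
    (h : ∀ᶠ k in hyperfilter ℕ, ∑ i, m i • ζ i (t k) = a) : m = 0 := by
  set η : K →+ K := ∑ i, m i • ζ i with hη
  have hη_apply : ∀ x, η x = ∑ i, algebraMap (ZMod p) K (m i) * ζ i x := by
    intro x
    simp [hη, Algebra.smul_def]
  suffices η = 0 from funext (Fintype.linearIndependent_iff.1 hind m this)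
  have hinf : {k | η (t k) = a}.Infinite := by
    intro hfin
    refine hfin.notMem_hyperfilter (h.mono fun k hk => ?_)
    simpa [hη] using hk
  obtain ⟨k₀, hk₀⟩ := hinf.nonempty
  -- Differences of points with equal image lie in the kernel.
  have hker : {x | η x = 0}.Infinite := by
    refine (hinf.image (f := fun k => t k - t k₀) fun i _ j _ hij => ht (by simpa using hij)).mono ?_
    rintro _ ⟨k, hk, rfl⟩
    simp only [Set.mem_ofPred_eq] at hk hk₀ ⊢
    rw [map_sub, hk, hk₀, sub_self]
  let u : ℕ → K := fun k => hker.natEmbedding _ k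
  have hu : u.Injective := fun i j hij => (hker.natEmbedding _).injective (Subtype.ext hij)
  have hu0 : ∀ k, η (u k) = 0 := fun k => (hker.natEmbedding _ k).2
  ext x₀
  -- Conjugating `u` to its translate by `x₀` carries the vanishing of `η` from one to the other.
  obtain ⟨σ, hσ, hσu⟩ := hc.exists_ringEquiv hu (y := fun k => x₀ + u k)
    fun i j hij => hu (by simpa using hij)
  have hcη : ∀ x : ℕ → K, c (η ∘ x) = ∑ i, diag c (algebraMap (ZMod p) K (m i)) * c (ζ i ∘ x) := by
    intro x
    have : η ∘ x = ∑ i, Pi.constRingHom ℕ K (algebraMap (ZMod p) K (m i)) * (ζ i ∘ x) := by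
      funext k
      simp [hη_apply]
    rw [this, map_sum]
    simp [diag]
  have h1 : σ (c (η ∘ u)) = c (η ∘ fun k => x₀ + u k) := by
    simp only [hcη, map_sum, map_mul, hσ]
    exact Finset.sum_congr rfl fun i _ => by rw [hc.ringEquiv_apply_comp (hdef i) hσ hσu]
  have h2 : η ∘ u = 0 := funext hu0
  rw [h2, map_zero, map_zero, ← map_zero c, hc.apply_eq_iff] at h1
  obtain ⟨k, hk⟩ := h1.exists
  simpa [hu0] using hk.symm

end IsUltrapower

end

/-! ### Reducts, and the structures `(K, G)`. -/

section

open FirstOrder.Ring FirstOrder.Field Filter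

section Reduct

variable {L : FirstOrder.Language.{u, v}} {L' : FirstOrder.Language} {M N : Type*}
  [L.Structure M] [L'.Structure M] [L.Structure N] [L'.Structure N]
  (φ : L →ᴸ L') [φ.IsExpansionOn M] [φ.IsExpansionOn N]

/-- An embedding of structures is an embedding of their reducts. -/
def embeddingReduct (f : M ↪[L'] N) : M ↪[L] N where
  toEmbedding := f.toEmbedding
  map_fun' g x := by
    have := f.map_fun (φ.onFunction g) x
    rwa [φ.map_onFunction, φ.map_onFunction] at this
  map_rel' r x := by
    have := f.map_rel (φ.onRelation r) x
    rwa [φ.map_onRelation, φ.map_onRelation] at this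

/-- An elementary embedding of structures is an elementary embedding of their reducts. -/
def elementaryEmbeddingReduct (f : M ↪ₑ[L'] N) : M ↪ₑ[L] N where
  toFun := f
  map_formula' n ψ x := by
    have := f.map_formula (φ.onFormula ψ) x
    rwa [φ.realize_onFormula, φ.realize_onFormula] at this

end Reduct

/-- The underlying field of a model of the model companion is algebraically closed. -/
theorem IsModelCompanion.model_ACF {p : ℕ} (hp : p.Prime) {T : ringPredLang.Theory}
    (hT : IsModelCompanion.{0, 0, w} (theoryACFSubgroup p) T) (N : Theory.ModelType.{0, 0, w} T)
    [Language.ring.Structure N]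
    [(LHom.sumInl : Language.ring →ᴸ ringPredLang).IsExpansionOn N] :
    N ⊨ Theory.ACF p := by
  obtain ⟨M, ⟨f⟩⟩ := hT.embeds_back N
  obtain ⟨N', ⟨g⟩⟩ := hT.embeds M
  let _ := (LHom.sumInl : Language.ring →ᴸ ringPredLang).reduct M
  let _ := (LHom.sumInl : Language.ring →ᴸ ringPredLang).reduct N'
  have hM : M ⊨ Theory.ACF p :=
    (LHom.onTheory_model LHom.sumInl _).1 (Theory.Model.mono M.is_model Set.subset_union_left)
  exact model_ACF_of_elementaryEmbedding hp (embeddingReduct LHom.sumInl f)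
    (embeddingReduct LHom.sumInl g)
    (elementaryEmbeddingReduct LHom.sumInl
      (hT.modelComplete.elementaryEmbedding N N' (g.comp f))) (fun _ => rfl) hM

section Pair

variable {K : Type*} [Field K] [CompatibleRing K] (G : AddSubgroup K)

theorem realize_addTerm {α : Type} (s t : ringPredLang.Term α) (v : α → K) :
    letI := pairStructure G
    (addTerm s t).realize v = s.realize v + t.realize v := by
  let _ := pairStructure G
  exact Term.realize_functions_apply₂.trans (CompatibleRing.funMap_add _)

theorem realize_negTerm {α : Type} (t : ringPredLang.Term α) (v : α → K) :
    letI := pairStructure G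
    (negTerm t).realize v = -t.realize v := by
  let _ := pairStructure G
  exact Term.realize_functions_apply₁.trans (CompatibleRing.funMap_neg _)

theorem realize_zeroTerm {α : Type} (v : α → K) :
    letI := pairStructure G
    (zeroTerm : ringPredLang.Term α).realize v = 0 := by
  exact CompatibleRing.funMap_zero _

theorem realize_predG {α : Type} {n : ℕ} (t : ringPredLang.Term (α ⊕ Fin n)) (v : α → K)
    (xs : Fin n → K) :
    letI := pairStructure G
    (predG t).Realize v xs ↔ t.realize (Sum.elim v xs) ∈ G := by
  exact Iff.rfl

theorem pairModels_addSubgroupAxioms : PairModels G addSubgroupAxioms := by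
  let _ := pairStructure G
  refine Theory.model_iff _ |>.2 ?_
  rintro _ (rfl | rfl | rfl)
  · refine (realize_predG G _ _ _).2 ?_
    rw [realize_zeroTerm]
    exact G.zero_mem
  · intro x y hx hy
    refine (realize_predG G _ _ _).2 ?_
    rw [realize_addTerm]
    exact G.add_mem hx hy
  · intro x hx
    refine (realize_predG G _ _ _).2 ?_
    rw [realize_negTerm]
    exact G.neg_mem hx

theorem pairModels_theoryACFSubgroup {p : ℕ} (h : K ⊨ Theory.ACF p) :
    PairModels G (theoryACFSubgroup p) := by
  let _ := unaryPredStructure (G : Set K)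
  exact (LHom.onTheory_model (LHom.sumInl : Language.ring →ᴸ ringPredLang) _).2 h |>.union
    (pairModels_addSubgroupAxioms G)

/-- A ring homomorphism of fields inducing an embedding of pairs. -/
def pairEmbedding {L : Type*} [Field L] [CompatibleRing L] (H : AddSubgroup L) (f : K →+* L)
    (hf : ∀ x, f x ∈ H ↔ x ∈ G) :
    letI := pairStructure G
    letI := pairStructure H
    K ↪[ringPredLang] L :=
  letI := pairStructure G
  letI := pairStructure H
  { toFun := f
    inj' := f.injective
    map_fun' := by
      rintro n (g | g) x
      · cases g with
        | add =>
          exact (congrArg f (CompatibleRing.funMap_add x)).trans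
            ((map_add f _ _).trans (CompatibleRing.funMap_add (f ∘ x)).symm)
        | mul =>
          exact (congrArg f (CompatibleRing.funMap_mul x)).trans
            ((map_mul f _ _).trans (CompatibleRing.funMap_mul (f ∘ x)).symm)
        | neg =>
          exact (congrArg f (CompatibleRing.funMap_neg x)).trans
            ((map_neg f _).trans (CompatibleRing.funMap_neg (f ∘ x)).symm)
        | zero =>
          exact (congrArg f (CompatibleRing.funMap_zero x)).trans
            ((map_zero f).trans (CompatibleRing.funMap_zero (f ∘ x)).symm)
        | one =>
          exact (congrArg f (CompatibleRing.funMap_one x)).trans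
            ((map_one f).trans (CompatibleRing.funMap_one (f ∘ x)).symm)
      · exact g.elim
    map_rel' := by
      rintro n (r | r) x
      · exact r.elim
      · cases r
        exact hf (x 0) }

end Pair

end

/-! ### Solving the congruences by model completeness. -/

section

open FirstOrder.Ring FirstOrder.Field Filter

/-- The formula `x₀ - x₁ ∈ G`. -/
def memSubFormula : ringPredLang.Formula (Fin 2) :=
  predG (addTerm (Term.var (Sum.inl 0)) (negTerm (Term.var (Sum.inl 1))))

theorem realize_memSubFormula {K : Type*} [Field K] [CompatibleRing K] (G : AddSubgroup K)
    (v : Fin 2 → K) :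
    letI := pairStructure G
    memSubFormula.Realize v ↔ v 0 - v 1 ∈ G := by
  let _ := pairStructure G
  refine (realize_predG G _ _ _).trans ?_
  rw [realize_addTerm, realize_negTerm, sub_eq_add_neg]
  rfl

theorem memSubFormula_isQF : memSubFormula.IsQF :=
  .of_isAtomic (.rel _ _)

/-- The formula saying, of the variables indexed by `K` taken as parameters, that there are `x` and
`y i` such that `φ i` holds of `x` and `y i`, and `y i - b i` lies in `G`, for every `i`. -/
noncomputable def solvabilityFormula {K : Type w} {n : ℕ}
    (φ : Fin n → Language.ring.Formula ((Set.univ : Set K) ⊕ Fin 2)) (b : Fin n → K) :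
    ringPredLang.Formula K :=
  Formula.iExs (Option (Fin n)) (Formula.iInf fun i =>
    (LHom.sumInl.onFormula (φ i)).relabel
        (Sum.elim (fun a : (Set.univ : Set K) => Sum.inl (a : K)) ![Sum.inr none, Sum.inr (some i)]) ⊓
      memSubFormula.relabel ![Sum.inr (some i), Sum.inl (b i)])

theorem realize_solvabilityFormula {K : Type w} {n : ℕ}
    (φ : Fin n → Language.ring.Formula ((Set.univ : Set K) ⊕ Fin 2)) (b : Fin n → K)
    {N : Type*} [ringPredLang.Structure N] [Language.ring.Structure N]
    [(LHom.sumInl : Language.ring →ᴸ ringPredLang).IsExpansionOn N] (v : K → N) :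
    (solvabilityFormula φ b).Realize v ↔ ∃ (x : N) (y : Fin n → N), ∀ i,
      (φ i).Realize (Sum.elim (fun a => v a) ![x, y i]) ∧
      memSubFormula.Realize ![y i, v (b i)] := by
  have key : ∀ (e : Option (Fin n) → N) (i : Fin n),
      ((LHom.sumInl.onFormula (φ i)).relabel
          (Sum.elim (fun a : (Set.univ : Set K) => Sum.inl (a : K)) ![Sum.inr none, Sum.inr (some i)]) ⊓
        memSubFormula.relabel ![Sum.inr (some i), Sum.inl (b i)]).Realize (Sum.elim v e) ↔
      (φ i).Realize (Sum.elim (fun a => v a) ![e none, e (some i)]) ∧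
        memSubFormula.Realize ![e (some i), v (b i)] := by
    intro e i
    rw [Formula.realize_inf, Formula.realize_relabel, Formula.realize_relabel,
      LHom.realize_onFormula]
    refine and_congr (iff_of_eq (congrArg _ (funext fun a => ?_)))
      (iff_of_eq (congrArg _ (funext fun a => ?_)))
    · rcases a with a | a
      · rfl
      · fin_cases a <;> rfl
    · fin_cases a <;> rfl
  simp only [solvabilityFormula, Formula.realize_iExs, Formula.realize_iInf, key]
  refine ⟨fun ⟨e, he⟩ => ⟨e none, fun i => e (some i), he⟩, fun ⟨x, y, hxy⟩ =>
    ⟨fun o => o.elim x y, hxy⟩⟩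

/-- A system of congruences `ζ i x ≡ ζ i (a i)` modulo `G` is solvable in every model of `ACFG`. -/
theorem IsModelACFG.exists_forall_sub_mem {p : ℕ} [Fact p.Prime] {K : Type w} [Field K]
    [Algebra (ZMod p) K] [CompatibleRing K] {G : AddSubgroup K} (hKG : IsModelACFG p G) {n : ℕ}
    {ζ : Fin n → K →+ K} (hdef : ∀ i, IsRingDefinable (ζ i))
    (hind : LinearIndependent (ZMod p) ζ) (a : Fin n → K) :
    ∃ x, ∀ i, ζ i x - ζ i (a i) ∈ G := by
  have hp : p.Prime := Fact.out
  obtain ⟨T, hT, hGT⟩ := hKG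
  let sK := pairStructure G
  let K' : Theory.ModelType.{0, 0, w} T := @Theory.ModelType.mk _ T K sK hGT inferInstance
  have : CharP K p := charP_of_injective_algebraMap (algebraMap (ZMod p) K).injective p
  have hK : K ⊨ Theory.ACF p := by
    let _ := unaryPredStructure (G : Set K)
    exact hT.model_ACF hp K'
  have := isAlgClosed_of_model_ACF p K
  obtain ⟨L, _, _, c, hc, hL⟩ := exists_isUltrapower p K
  have := isAlgClosed_of_model_ACF p L
  have : CharP L p := by
    have : Theory.fieldOfChar p |>.Model L := inferInstance
    exact charP_of_model_fieldOfChar p L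
  have : Infinite K := IsAlgClosed.instInfinite
  have := hc.uncountable
  let t : ℕ → K := Infinite.natEmbedding K
  have ht : t.Injective := (Infinite.natEmbedding K).injective
  let _ : Algebra (ZMod p) L := ZMod.algebra L p
  let d := IsUltrapower.diag c
  let z : Fin n → L := fun i => c (ζ i ∘ t) - d (ζ i (a i))
  let H : AddSubgroup L := G.map d.toAddMonoidHom ⊔
    (Submodule.span (ZMod p) (Set.range z)).toAddSubgroup
  have hz : ∀ i, z i ∈ H := fun i =>
    AddSubgroup.mem_sup_right (Submodule.subset_span ⟨i, rfl⟩)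
  have hH : ∀ x, d x ∈ H ↔ x ∈ G := by
    refine fun x => ⟨fun hx => ?_, fun hx => AddSubgroup.mem_sup_left ⟨x, hx, rfl⟩⟩
    obtain ⟨_, ⟨g, hg, rfl⟩, y, hy, hxy⟩ := AddSubgroup.mem_sup.1 hx
    obtain ⟨m, rfl⟩ := (Submodule.mem_span_range_iff_exists_fun _).1 hy
    -- The relation `hxy` puts `∑ m i • c (ζ i ∘ t)` in the diagonal copy of `K`, so the combination
    -- is constant along `t` on a set of the ultrafilter.
    have hm : m = 0 := by
      refine hc.eq_zero_of_eventually_const hdef hind ht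
        (a := x - g + ∑ i, m i • ζ i (a i)) ?_
      refine (hc.apply_eq_iff (fun k => ∑ i, m i • ζ i (t k))
        (fun _ => x - g + ∑ i, m i • ζ i (a i))).1 ?_
      have h1 : (fun k => ∑ i, m i • ζ i (t k)) = ∑ i, m i • (ζ i ∘ t) := by
        funext k
        simp
      change _ = d (x - g + ∑ i, m i • ζ i (a i))
      rw [h1, map_sum, map_add, map_sub, map_sum, ← hxy]
      simp only [ZMod.map_smul c, ZMod.map_smul d, z, smul_sub, Finset.sum_sub_distrib,
        RingHom.toAddMonoidHom_eq_coe, AddMonoidHom.coe_coe]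
      abel
    subst hm
    have : g = x := d.injective (by simpa using hxy)
    exact this ▸ hg
  let sL := pairStructure H
  let L' : Theory.ModelType.{0, 0, w} (theoryACFSubgroup p) :=
    @Theory.ModelType.mk _ _ L sL (pairModels_theoryACFSubgroup H hL) inferInstance
  obtain ⟨N, ⟨g⟩⟩ := hT.embeds L'
  let f : K ↪[ringPredLang] L := pairEmbedding G H d hH
  let h := hT.modelComplete.elementaryEmbedding K' N (g.comp f)
  let _ := (LHom.sumInl : Language.ring →ᴸ ringPredLang).reduct N
  have hN : N ⊨ Theory.ACF p := hT.model_ACF hp N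
  have := modelField_of_modelACF p N
  let _ := fieldOfModelField N
  let _ := compatibleRingOfModelField N
  have := isAlgClosed_of_model_ACF p N
  let _ := unaryPredStructure (G : Set K)
  let _ := unaryPredStructure (H : Set L)
  -- The graph formulas `φ i` may have quantifiers, so passing them from `L` to `N` needs
  -- elementarity in the ring language; for membership in `H`, which is atomic, an embedding
  -- suffices.
  obtain ⟨g', hg'⟩ := exists_elementaryEmbedding_of_uncountable (p := p)
    (embeddingReduct (LHom.sumInl : Language.ring →ᴸ ringPredLang) g)
  choose φ hφ using fun i => (hdef i).exists_formula
  have hsolN : (solvabilityFormula φ fun i => ζ i (a i)).Realize (h : K → N) := by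
    rw [realize_solvabilityFormula]
    refine ⟨g (c t), fun i => g (c (ζ i ∘ t)), fun i => ⟨?_, ?_⟩⟩
    · have h1 := (hc.realize_graph (hφ i) t (ζ i ∘ t)).2 rfl
      rw [← g'.map_formula] at h1
      convert! h1 using 1
      funext b
      rcases b with b | b
      · exact (hg' _).symm
      · fin_cases b
        · exact (hg' _).symm
        · exact (hg' _).symm
    · have h1 := (realize_memSubFormula H ![c (ζ i ∘ t), d (ζ i (a i))]).2 (hz i)
      have h2 := (memSubFormula_isQF.realize_embedding g).2 h1
      rw [Formula.Realize]
      convert! h2 using 1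
      funext b
      fin_cases b <;> rfl
  have hsolK : (solvabilityFormula φ fun i => ζ i (a i)).Realize (id : K → K) :=
    (h.map_formula _ id).1 hsolN
  obtain ⟨x, y, hxy⟩ := (realize_solvabilityFormula φ _ _).1 hsolK
  refine ⟨x, fun i => ?_⟩
  have h1 := (hφ i x (y i)).1 (hxy i).1
  have h2 := (realize_memSubFormula G _).1 (hxy i).2
  rw [h1]
  exact h2

end

theorem mainTheorem10 {p : ℕ} [Fact p.Prime]
    {K : Type w} [Field K] [Algebra (ZMod p) K] [FirstOrder.Ring.CompatibleRing K]
    (G : AddSubgroup K) (hKG : IsModelACFG p G)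
    {n : ℕ} (ζ : Fin n → K →+ K) (hdef : ∀ i, IsRingDefinable (ζ i))
    (hind : LinearIndependent (ZMod p) ζ) :
    ∃ e : (K ⧸ ⨅ i, G.comap (ζ i)) ≃+ (∀ i, K ⧸ G.comap (ζ i)),
      ∀ (x : K) (i : Fin n),
        e (QuotientAddGroup.mk x) i = QuotientAddGroup.mk x := by

  let F : K →+ ∀ i, K ⧸ G.comap (ζ i) :=
    AddMonoidHom.pi fun i => QuotientAddGroup.mk' (G.comap (ζ i))
  have hker : F.ker = ⨅ i, G.comap (ζ i) := by
    ext x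
    simp [F, AddMonoidHom.mem_ker, funext_iff, AddSubgroup.mem_iInf]
  have hsurj : Function.Surjective F := by
    intro y
    choose a ha using fun i => QuotientAddGroup.mk_surjective (y i)
    obtain ⟨x, hx⟩ := hKG.exists_forall_sub_mem hdef hind a
    refine ⟨x, funext fun i => ?_⟩
    rw [← ha i]
    refine (QuotientAddGroup.eq_iff_sub_mem).2 ?_
    simpa using hx i
  exact ⟨(QuotientAddGroup.quotientAddEquivOfEq hker.symm).trans
    (QuotientAddGroup.quotientKerEquivOfSurjective F hsurj), fun _ _ => rfl⟩
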